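/- **Setting.** Write $[n]=\{1,\dots,n\}$. A Markov chain on $[n]$ is identified with its transition matrix $P\in\mathbb R^{n\times n}$ (nonnegative entries, rows summing to $1$); it is reversible with uniform invariant measure if $\nu P=\nu$ and $\nu(x)P(x,y)=\nu(y)P(y,x)$ for all $x,y$, where $\nu\equiv 1/n$. Let $\langle f,g\rangle_\nu=\frac1n\sum_x f(x)g(x)$. Every $M\in\mathbb R^{n\times n}$ has a singular value decomposition $M(x,y)=\sum_{i=1}^n\sigma_i\,\psi_i(x)\,\phi_i(y)\,\nu(y)$ with $\sigma_1\ge\dots\ge\sigma_n\ge0$ and $(\psi_i)_i$, $(\phi_i)_i$ orthonormal bases for $\langle\cdot,\cdot\rangle_\nu$, and its spectral recoverability is $\xi(M)=\max_x\sum_i\sigma_i\psi_i(x)^2$ (independent of the choice of the decomposition). Let $\|A\|_{\infty,\infty}=\sup_{f\neq0}\|Af\|_\infty/\|f\|_\infty$. Given $Z\in\mathbb N^n$, for each $x\in[n]$ one observes $Z_x$ transitions from $x$, with endpoints drawn from $P(x,\cdot)$, all transitions being independent; $\mathbb P_P$ is the law of this sample. For a set $\mathcal P$ of transition matrices, an estimator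 $\widehat P$ (a matrix-valued function of the sample) is $(\varepsilon,\delta)$-PAC for $\mathcal P$ and $\|\cdot\|_{\infty,\infty}$ if $\mathbb P_P\big[\|\widehat P-P\|_{\infty,\infty}>\varepsilon\big]\le\delta$ for all $P\in\mathcal P$. **Theorem.** There is a universal constant $C>0$ such that for every sufficiently large integer $n$ and every real $\kappa\in[1,n]$ there exists a family $\mathcal P_\kappa$ of Markov chains on $[n]$ with the following properties: (i) every $P\in\mathcal P_\kappa$ is reversible with uniform invariant measure; (ii) $\xi(P)\le\kappa$ for every $P\in\mathcal P_\kappa$; (iii) for every $\varepsilon\in(0,1/3)$ with $3\varepsilon\le\kappa-1$ (the second condition is automatic when $\kappa\ge2$), every $\delta\in[0,1/2]$ and every $Z\in\mathbb N^n$ with $\sum_{x\in[n]}Z_x\le C\,\varepsilon^{-2}\max(n,\kappa^2)$, there exists no $(\varepsilon,\delta)$-PAC estimator for $\mathcal P_\kappa$ and the norm $\|\cdot\|_{\infty,\infty}$ based on a sample with counts $Z$. -/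

import Mathlib

/-- The uniform probability measure on `Fin n`, as a weight function. -/
noncomputable def uniformWeight (n : ℕ) : Fin n → ℝ := fun _ => 1 / (n : ℝ)

/-- A singular value decomposition of `M` with respect to the weight `ν`, that is
`M = ∑ i, σ i • ψ i (φ i)†`, where `f† x = ν x * f x`, the `σ i` are nonnegative and in nonincreasing
order, and `ψ` and `φ` are orthonormal bases for `⟪f, g⟫_ν = ∑ x, ν x * f x * g x`. -/
structure WeightedSVD {n : ℕ} (ν : Fin n → ℝ) (M : Matrix (Fin n) (Fin n) ℝ) where
  /-- singular values -/
  σ : Fin n → ℝ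
  /-- left singular vectors -/
  ψ : Fin n → Fin n → ℝ
  /-- right singular vectors -/
  φ : Fin n → Fin n → ℝ
  σ_nonneg : ∀ i, 0 ≤ σ i
  σ_antitone : Antitone σ
  ψ_orthonormal : ∀ i j, ∑ x, ν x * ψ i x * ψ j x = if i = j then 1 else 0
  φ_orthonormal : ∀ i j, ∑ x, ν x * φ i x * φ j x = if i = j then 1 else 0
  eq_sum : ∀ x y, M x y = ∑ i, σ i * ψ i x * (ν y * φ i y)

/-- The quantity `max_x ∑ i, σ i * ψ i x ^ 2` of one singular value decomposition. -/
noncomputable def WeightedSVD.recoverability {n : ℕ} {ν : Fin n → ℝ}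
    {M : Matrix (Fin n) (Fin n) ℝ} (S : WeightedSVD ν M) : ℝ :=
  ⨆ x, ∑ i, S.σ i * S.ψ i x ^ 2

open Classical in
/-- The spectral recoverability `ξ(M) = max_x ∑ i, σ i * ψ i x ^ 2` of `M` with respect to `ν`.
When `ν` is positive, a decomposition exists (`WeightedSVD.nonempty`) and the value does not
depend on it (`spectralRecoverability_eq`). -/
noncomputable def spectralRecoverability {n : ℕ} (ν : Fin n → ℝ)
    (M : Matrix (Fin n) (Fin n) ℝ) : ℝ :=
  if h : Nonempty (WeightedSVD ν M) then h.some.recoverability else 0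

theorem WeightedSVD.nonempty {n : ℕ} {ν : Fin n → ℝ} (hν : ∀ x, 0 < ν x)
    (M : Matrix (Fin n) (Fin n) ℝ) : Nonempty (WeightedSVD ν M) := by
  classical
  let A : Matrix (Fin n) (Fin n) ℝ := fun x y => √(ν x) * M x y / √(ν y)
  let T : EuclideanSpace ℝ (Fin n) →ₗ[ℝ] EuclideanSpace ℝ (Fin n) := Matrix.toLpLin 2 2 A
  have hpos : (LinearMap.adjoint T ∘ₗ T).IsPositive := LinearMap.isPositive_adjoint_comp_self T
  have hT := hpos.isSymmetric
  have hn : Module.finrank ℝ (EuclideanSpace ℝ (Fin n)) = n := by simp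
  let v := hT.eigenvectorBasis hn
  let μ := hT.eigenvalues hn
  have hμ : ∀ i, 0 ≤ μ i := hpos.nonneg_eigenvalues hn
  have hin : ∀ i j, inner ℝ (T (v i)) (T (v j)) = if i = j then μ i else 0 := by
    intro i j
    have h1 : inner ℝ (T (v i)) (T (v j)) = inner ℝ ((LinearMap.adjoint T ∘ₗ T) (v i)) (v j) := by
      simp [LinearMap.adjoint_inner_left]
    rw [h1, hT.apply_eigenvectorBasis hn i, inner_smul_left]
    have := orthonormal_iff_ite.1 v.orthonormal i j
    rw [this]
    simp [μ]
  let w : Fin n → EuclideanSpace ℝ (Fin n) := fun i => (√(μ i))⁻¹ • T (v i)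
  let s : Set (Fin n) := {i | μ i ≠ 0}
  have hw : Orthonormal ℝ (s.domRestrict w) := by
    rw [orthonormal_iff_ite]
    rintro ⟨i, hi⟩ ⟨j, hj⟩
    have hij : inner ℝ (s.domRestrict w ⟨i, hi⟩) (s.domRestrict w ⟨j, hj⟩)
        = (√(μ i))⁻¹ * ((√(μ j))⁻¹ * if i = j then μ i else 0) := by
      rw [← hin i j]
      simp only [Set.domRestrict_apply, w, inner_smul_left, inner_smul_right, conj_trivial]
      ring
    rw [hij]
    simp only [Subtype.mk.injEq]
    split_ifs with h
    · subst h
      have h0 : √(μ i) ≠ 0 := Real.sqrt_ne_zero'.2 (lt_of_le_of_ne (hμ i) (Ne.symm hi))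
      have h2 := Real.mul_self_sqrt (hμ i)
      field_simp
      nlinarith
    · simp
  obtain ⟨b, hb⟩ := hw.exists_orthonormalBasis_extension_of_card_eq (by simp)
  have hTv : ∀ i, T (v i) = √(μ i) • b i := by
    intro i
    by_cases hi : μ i = 0
    · have : T (v i) = 0 := by
        rw [← inner_self_eq_zero (𝕜 := ℝ), hin]; simp [hi]
      simp [this, hi]
    · have h0 : √(μ i) ≠ 0 := Real.sqrt_ne_zero'.2 (lt_of_le_of_ne (hμ i) (Ne.symm hi))
      rw [hb i hi, smul_smul, mul_inv_cancel₀ h0, one_smul]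
  have hs : ∀ x, 0 < √(ν x) := fun x => Real.sqrt_pos.2 (hν x)
  have hss : ∀ x, √(ν x) * √(ν x) = ν x := fun x => Real.mul_self_sqrt (hν x).le
  have key : ∀ x y, A x y = ∑ i, √(μ i) * b i x * v i y := by
    intro x y
    have h1 : T (EuclideanSpace.single y 1) x = A x y := by
      simp [T, Matrix.toLpLin_apply]
    have h2 := v.sum_repr' (EuclideanSpace.single y (1 : ℝ))
    rw [← h1, ← h2, map_sum]
    simp [hTv, EuclideanSpace.inner_single_right]
    exact Finset.sum_congr rfl fun i _ => by ring
  have orth : ∀ (c : OrthonormalBasis (Fin n) ℝ (EuclideanSpace ℝ (Fin n))) (i j : Fin n),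
      ∑ x, ν x * (c i x / √(ν x)) * (c j x / √(ν x)) = if i = j then 1 else 0 := by
    intro c i j
    rw [← orthonormal_iff_ite.1 c.orthonormal i j, PiLp.inner_apply]
    refine Finset.sum_congr rfl fun x _ => ?_
    have := (hs x).ne'
    rw [← hss x]
    simp
    field_simp
  refine ⟨⟨fun i => √(μ i), fun i x => b i x / √(ν x), fun i x => v i x / √(ν x),
    fun i => Real.sqrt_nonneg _, fun i j hij => Real.sqrt_le_sqrt (hT.eigenvalues_antitone hn hij),
    orth b, orth v, fun x y => ?_⟩⟩
  have h3 : M x y = A x y * √(ν y) / √(ν x) := by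
    have := (hs x).ne'
    have := (hs y).ne'
    simp only [A]
    field_simp
  rw [h3, key, Finset.sum_mul, Finset.sum_div]
  refine Finset.sum_congr rfl fun i _ => ?_
  have := (hs x).ne'
  have := (hs y).ne'
  have := hss y
  field_simp
  linear_combination (√(μ i) * b i x * v i y) * this

open scoped MatrixOrder in
theorem WeightedSVD.sum_eq {n : ℕ} {ν : Fin n → ℝ} (hν : ∀ x, 0 < ν x)
    {M : Matrix (Fin n) (Fin n) ℝ} (S S' : WeightedSVD ν M) (x : Fin n) :
    ∑ i, S.σ i * S.ψ i x ^ 2 = ∑ i, S'.σ i * S'.ψ i x ^ 2 := by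
  classical
  have hs : ∀ x, 0 < √(ν x) := fun x => Real.sqrt_pos.2 (hν x)
  have hss : ∀ x, √(ν x) * √(ν x) = ν x := fun x => Real.mul_self_sqrt (hν x).le
  let A : Matrix (Fin n) (Fin n) ℝ := fun x y => √(ν x) * M x y / √(ν y)
  let U : WeightedSVD ν M → Matrix (Fin n) (Fin n) ℝ := fun S x i => √(ν x) * S.ψ i x
  let V : WeightedSVD ν M → Matrix (Fin n) (Fin n) ℝ := fun S x i => √(ν x) * S.φ i x
  let K : WeightedSVD ν M → Matrix (Fin n) (Fin n) ℝ := fun S =>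
    U S * Matrix.diagonal S.σ * (U S).transpose
  have hUa : ∀ S x i, U S x i = √(ν x) * S.ψ i x := fun _ _ _ => rfl
  have hVa : ∀ S x i, V S x i = √(ν x) * S.φ i x := fun _ _ _ => rfl
  have hU : ∀ S, (U S).transpose * U S = 1 := by
    intro S
    ext i j
    rw [Matrix.mul_apply, Matrix.one_apply, ← S.ψ_orthonormal i j]
    refine Finset.sum_congr rfl fun x _ => ?_
    rw [Matrix.transpose_apply, hUa, hUa]
    linear_combination (S.ψ i x * S.ψ j x) * hss x
  have hV : ∀ S, (V S).transpose * V S = 1 := by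
    intro S
    ext i j
    rw [Matrix.mul_apply, Matrix.one_apply, ← S.φ_orthonormal i j]
    refine Finset.sum_congr rfl fun x _ => ?_
    rw [Matrix.transpose_apply, hVa, hVa]
    linear_combination (S.φ i x * S.φ j x) * hss x
  have hA : ∀ S, A = U S * Matrix.diagonal S.σ * (V S).transpose := by
    intro S
    ext x y
    have h1 : A x y = √(ν x) * M x y / √(ν y) := rfl
    rw [h1, Matrix.mul_apply, S.eq_sum, Finset.mul_sum, Finset.sum_div]
    refine Finset.sum_congr rfl fun i _ => ?_
    rw [Matrix.mul_diagonal, Matrix.transpose_apply, hUa, hVa]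
    have := (hs y).ne'
    have := hss y
    field_simp
    linear_combination (-√(ν x) * S.σ i * S.ψ i x * S.φ i y) * this
  have hK : ∀ S, K S * K S = A * A.transpose := by
    intro S
    rw [hA S]
    simp only [K, Matrix.transpose_mul, Matrix.transpose_transpose, Matrix.diagonal_transpose,
      Matrix.mul_assoc]
    rw [← Matrix.mul_assoc (U S).transpose (U S), hU, ← Matrix.mul_assoc (V S).transpose (V S), hV]
  have hpos : ∀ S, 0 ≤ K S := by
    intro S
    rw [Matrix.nonneg_iff_posSemidef]
    have := (Matrix.PosSemidef.diagonal (d := S.σ) (fun i => S.σ_nonneg i)).mul_mul_conjTranspose_same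
      (U S)
    simpa [K, Matrix.conjTranspose_eq_transpose_of_trivial] using this
  have hKK : K S = K S' := by
    have h1 := CFC.sqrt_unique (hK S) (hpos S)
    have h2 := CFC.sqrt_unique (hK S') (hpos S')
    rw [← h1, ← h2]
  have hval : ∀ S : WeightedSVD ν M, K S x x = ν x * ∑ i, S.σ i * S.ψ i x ^ 2 := by
    intro S
    have h1 : K S = U S * Matrix.diagonal S.σ * (U S).transpose := rfl
    rw [h1, Matrix.mul_apply, Finset.mul_sum]
    refine Finset.sum_congr rfl fun i _ => ?_
    rw [Matrix.mul_diagonal, Matrix.transpose_apply, hUa]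
    linear_combination (S.σ i * S.ψ i x ^ 2) * hss x
  have := hval S
  rw [hKK, hval S'] at this
  exact (mul_left_cancel₀ (hν x).ne' this).symm

theorem spectralRecoverability_eq {n : ℕ} {ν : Fin n → ℝ} (hν : ∀ x, 0 < ν x)
    {M : Matrix (Fin n) (Fin n) ℝ} (S : WeightedSVD ν M) :
    spectralRecoverability ν M = ⨆ x, ∑ i, S.σ i * S.ψ i x ^ 2 := by
  unfold spectralRecoverability
  rw [dif_pos ⟨S⟩]
  exact iSup_congr fun x => WeightedSVD.sum_eq hν _ S x

/-- `‖A‖_{∞,∞}`, the operator norm of `A` for the supremum norms. -/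
noncomputable def inftyInftyNorm {n m : ℕ} (A : Matrix (Fin n) (Fin m) ℝ) : ℝ :=
  ‖ContinuousLinearMap.mk (Matrix.mulVecLin A)‖

/-- `ν` is invariant for `P`. -/
def IsInvariantWeight {n : ℕ} (ν : Fin n → ℝ) (P : Matrix (Fin n) (Fin n) ℝ) : Prop :=
  Matrix.vecMul ν P = ν

/-- `P` is reversible with respect to `ν` (detailed balance). -/
def IsReversibleWeight {n : ℕ} (ν : Fin n → ℝ) (P : Matrix (Fin n) (Fin n) ℝ) : Prop :=
  ∀ x y, ν x * P x y = ν y * P y x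

/-- The data of the generative model with `Z x` transitions sampled from each state `x`: the value
at `⟨x, t⟩` is the endpoint of the `t`-th transition that starts in `x`. -/
abbrev TransitionSample {n : ℕ} (m : ℕ) (Z : Fin n → ℕ) : Type :=
  (Σ x : Fin n, Fin (Z x)) → Fin m

/-- The measure `P x ·` on `Fin m`. -/
noncomputable def rowMeasure {n m : ℕ} (P : Matrix (Fin n) (Fin m) ℝ) (x : Fin n) :
    MeasureTheory.Measure (Fin m) :=
  ∑ y, ENNReal.ofReal (P x y) • MeasureTheory.Measure.dirac y

/-- The law of the data under `P`: all transitions are independent, and those which start in `x`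
have law `P x ·`. -/
noncomputable def sampleLaw {n m : ℕ} (P : Matrix (Fin n) (Fin m) ℝ) (Z : Fin n → ℕ) :
    MeasureTheory.Measure (TransitionSample m Z) :=
  MeasureTheory.Measure.pi fun s => rowMeasure P s.1

/-- The estimator `est` of `f P` is `(ε, δ)`-PAC for the class `Pc` and the norm `N`, from `Z x`
transitions out of each state `x`. -/
def IsPACEstimator {n m : ℕ} {E : Type*} [Sub E] (Pc : Set (Matrix (Fin n) (Fin m) ℝ))
    (f : Matrix (Fin n) (Fin m) ℝ → E) (N : E → ℝ) (Z : Fin n → ℕ) (ε δ : ℝ)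
    (est : TransitionSample m Z → E) : Prop :=
  ∀ P ∈ Pc, sampleLaw P Z {ω | ε < N (est ω - f P)} ≤ ENNReal.ofReal δ

/-!
The chain that jumps to a uniform state is perturbed in the directions of balanced sign kernels
`B`, which gives the transition probabilities `(1 + 3 ε B x y) / n`. Two perturbations whose sign
patterns differ in more than about a third of some row are too far apart for one estimate to be
`ε`-close to both. Under the uniform law as reference measure one transition carries information of
order `ε²`, so a second moment version of Fano's inequality forces the sample size to be at least of
order `ε⁻²` times the logarithm of the number of sign patterns divided by the number of those that
are compatible with one estimate.

Rank-one sign matrices `u uᵀ` give positive semidefinite directions, for which the singular value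
decomposition is an eigendecomposition and the recoverability is read off the diagonal: it is at
most `1 + 3 ε`. There are exponentially many (in `n`) such patterns, whence the bound `n / ε²`.
Arbitrary symmetric sign matrices only satisfy `ξ ≤ √(2 n)`, by the Cauchy–Schwarz inequality, but
there are exponentially many in `n²` of them. Once `2 n ≤ κ²` they are all admissible, and the bound
`n² / ε²` is at least `κ² / ε²`.
-/

section SpectralRecoverability

variable {n : ℕ} {ν : Fin n → ℝ} {M : Matrix (Fin n) (Fin n) ℝ}

theorem exists_antitone_eigenvalues_of_posSemidef (hM : M.PosSemidef) :
    ∃ (μ : Fin n → ℝ) (v : OrthonormalBasis (Fin n) ℝ (EuclideanSpace ℝ (Fin n))),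
      (∀ i, 0 ≤ μ i) ∧ Antitone μ ∧ ∀ x y, M x y = ∑ i, μ i * v i x * v i y := by
  have hT := Matrix.isPositive_toEuclideanLin_iff.2 hM
  have hn : Module.finrank ℝ (EuclideanSpace ℝ (Fin n)) = n := finrank_euclideanSpace_fin
  set v := hT.isSymmetric.eigenvectorBasis hn
  refine ⟨hT.isSymmetric.eigenvalues hn, v, hT.nonneg_eigenvalues hn,
    hT.isSymmetric.eigenvalues_antitone hn, fun x y => ?_⟩
  calc M x y = M.toEuclideanLin (EuclideanSpace.single y 1) x := by
        simp [Matrix.toLpLin_apply]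
    _ = ∑ i, v i y * M.toEuclideanLin (v i) x := by
        conv_lhs => rw [← v.sum_repr' (EuclideanSpace.single y 1)]
        simp [EuclideanSpace.inner_single_right]
    _ = _ := Finset.sum_congr rfl fun i _ => by
        rw [hT.isSymmetric.apply_eigenvectorBasis hn i]
        simp only [RCLike.ofReal_real_eq_id, id_eq, PiLp.smul_apply, smul_eq_mul, v]
        ring

theorem WeightedSVD.exists_φ_eq_ψ_of_posSemidef (hν : ∀ x, 0 < ν x)
    (hM : (Matrix.diagonal ν * M).PosSemidef) : ∃ S : WeightedSVD ν M, S.φ = S.ψ := by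
  have hs (x : Fin n) : 0 < √(ν x) := Real.sqrt_pos.2 (hν x)
  have hss (x : Fin n) : √(ν x) ^ 2 = ν x := Real.sq_sqrt (hν x).le
  obtain ⟨μ, v, hμ₀, hμ, hsum⟩ := exists_antitone_eigenvalues_of_posSemidef <|
    hM.mul_mul_conjTranspose_same (Matrix.diagonal fun x => (√(ν x))⁻¹)
  have orth (i j : Fin n) :
      ∑ x, ν x * (v i x / √(ν x)) * (v j x / √(ν x)) = if i = j then 1 else 0 := by
    rw [← orthonormal_iff_ite.1 v.orthonormal i j, PiLp.inner_apply]
    refine Finset.sum_congr rfl fun x _ => ?_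
    have := (hs x).ne'
    nth_rw 1 [← hss x]
    simp only [RCLike.inner_apply, conj_trivial]
    field_simp
  refine ⟨⟨μ, fun i x => v i x / √(ν x), fun i x => v i x / √(ν x), hμ₀, hμ, orth, orth,
    fun x y => ?_⟩, rfl⟩
  have hxy := hsum x y
  rw [Matrix.diagonal_conjTranspose, Matrix.mul_diagonal, Matrix.diagonal_mul,
    Matrix.diagonal_mul, Pi.star_apply, star_trivial] at hxy
  have := (hs x).ne'
  have := (hs y).ne'
  calc M x y = (√(ν x))⁻¹ * (ν x * M x y) * (√(ν y))⁻¹ * (√(ν y) / √(ν x)) := by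
        nth_rw 2 [← hss x]
        field_simp
    _ = _ := by
        rw [hxy, Finset.sum_mul]
        refine Finset.sum_congr rfl fun i _ => ?_
        field_simp
        rw [hss y]

theorem spectralRecoverability_eq_iSup_diag (hν : ∀ x, 0 < ν x)
    (hM : (Matrix.diagonal ν * M).PosSemidef) :
    spectralRecoverability ν M = ⨆ x, M x x / ν x := by
  obtain ⟨S, hS⟩ := WeightedSVD.exists_φ_eq_ψ_of_posSemidef hν hM
  rw [spectralRecoverability_eq hν S]
  refine iSup_congr fun x => ?_
  have := (hν x).ne'
  rw [S.eq_sum, hS, Finset.sum_div]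
  refine Finset.sum_congr rfl fun i _ => ?_
  field_simp

theorem WeightedSVD.sum_sq_ψ (S : WeightedSVD ν M) (x : Fin n) :
    ∑ i, S.ψ i x ^ 2 = (ν x)⁻¹ := by
  have hψ : Matrix.of S.ψ * (Matrix.diagonal ν * (Matrix.of S.ψ).transpose) = 1 := by
    ext i j
    rw [Matrix.mul_apply, Matrix.one_apply, ← S.ψ_orthonormal i j]
    refine Finset.sum_congr rfl fun x _ => ?_
    rw [Matrix.diagonal_mul, Matrix.transpose_apply, Matrix.of_apply, Matrix.of_apply]
    ring
  have hxx := congrArg (· x x) (mul_eq_one_comm.1 hψ)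
  rw [Matrix.mul_assoc, Matrix.diagonal_mul, Matrix.mul_apply, Matrix.one_apply_eq] at hxx
  simp only [Matrix.transpose_apply, Matrix.of_apply, ← pow_two] at hxx
  exact eq_inv_of_mul_eq_one_right hxx

theorem WeightedSVD.sum_sq_σ_mul_ψ (S : WeightedSVD ν M) (hν : ∀ x, 0 < ν x) (x : Fin n) :
    ∑ i, (S.σ i * S.ψ i x) ^ 2 = ∑ y, M x y ^ 2 / ν y := by
  have expand (y : Fin n) : M x y ^ 2 / ν y =
      ∑ i, ∑ j, S.σ i * S.ψ i x * (S.σ j * S.ψ j x) * (ν y * S.φ i y * S.φ j y) := by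
    have := (hν y).ne'
    rw [S.eq_sum, pow_two, Finset.sum_mul_sum, Finset.sum_div]
    refine Finset.sum_congr rfl fun i _ => ?_
    rw [Finset.sum_div]
    refine Finset.sum_congr rfl fun j _ => ?_
    field_simp
  simp_rw [expand]
  rw [Finset.sum_comm]
  refine Finset.sum_congr rfl fun i _ => ?_
  rw [Finset.sum_comm]
  simp_rw [← Finset.mul_sum, S.φ_orthonormal]
  simp [pow_two]

theorem spectralRecoverability_le_of_sum_sq_le (hν : ∀ x, 0 < ν x) {c : ℝ} (hc : 0 ≤ c)
    (hM : ∀ x, (∑ y, M x y ^ 2 / ν y) / ν x ≤ c ^ 2) : spectralRecoverability ν M ≤ c := by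
  obtain ⟨S⟩ := WeightedSVD.nonempty hν M
  rw [spectralRecoverability_eq hν S]
  refine Real.iSup_le (fun x => le_of_sq_le_sq ?_ hc) hc
  calc (∑ i, S.σ i * S.ψ i x ^ 2) ^ 2 = (∑ i, S.σ i * S.ψ i x * S.ψ i x) ^ 2 := by
        simp only [pow_two, mul_assoc]
    _ ≤ (∑ i, (S.σ i * S.ψ i x) ^ 2) * ∑ i, S.ψ i x ^ 2 := Finset.sum_mul_sq_le_sq_mul_sq ..
    _ = (∑ y, M x y ^ 2 / ν y) / ν x := by
        rw [S.sum_sq_σ_mul_ψ hν, S.sum_sq_ψ, div_eq_mul_inv]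
    _ ≤ c ^ 2 := hM x

end SpectralRecoverability

section Counting

open Finset

theorem sum_pow_hammingDist {ι α R : Type*} [Fintype ι] [DecidableEq ι] [Fintype α]
    [DecidableEq α] [CommRing R] (f : ι → α) (x : R) :
    ∑ g, x ^ hammingDist g f = (1 + (Fintype.card α - 1) * x) ^ Fintype.card ι := by
  have hsum (i : ι) : ∑ a, (if a ≠ f i then x else 1) = 1 + (Fintype.card α - 1) * x := by
    have : Nonempty α := ⟨f i⟩
    rw [sum_ite, sum_const, sum_const, filter_ne', card_erase_of_mem (mem_univ _)]
    simp [Nat.cast_sub Fintype.card_pos, filter_eq', add_comm]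
  trans ∏ i, ∑ a, if a ≠ f i then x else 1
  · rw [Fintype.prod_sum]
    refine sum_congr rfl fun g _ => ?_
    rw [prod_ite, prod_const, prod_const_one, mul_one, hammingDist]
  · simp_rw [hsum, prod_const, card_univ]

theorem pow_mul_card_hammingBall_le {ι α : Type*} [Fintype ι] [DecidableEq ι] [Fintype α]
    [DecidableEq α] (f : ι → α) (d : ℕ) {x : ℝ} (hx₀ : 0 ≤ x) (hx₁ : x ≤ 1) :
    x ^ d * #{g | hammingDist g f ≤ d} ≤ (1 + (Fintype.card α - 1) * x) ^ Fintype.card ι := by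
  calc x ^ d * #{g | hammingDist g f ≤ d} = ∑ g with hammingDist g f ≤ d, x ^ d := by
        rw [sum_const, nsmul_eq_mul, mul_comm]
    _ ≤ ∑ g with hammingDist g f ≤ d, x ^ hammingDist g f :=
        sum_le_sum fun g hg => pow_le_pow_of_le_one hx₀ hx₁ (mem_filter.1 hg).2
    _ ≤ ∑ g, x ^ hammingDist g f := sum_le_univ_sum_of_nonneg fun g => by positivity
    _ = _ := sum_pow_hammingDist f x

theorem card_hammingBall_le_exp {ι α : Type*} [Fintype ι] [DecidableEq ι] [Fintype α]
    [DecidableEq α] (hα : Fintype.card α = 2) (f : ι → α) {d : ℕ}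
    (hd : 5 * d ≤ 2 * Fintype.card ι) :
    (#{g | hammingDist g f ≤ d} : ℝ) ≤
      Real.exp (-(Fintype.card ι / 100)) * Fintype.card (ι → α) := by
  set N := Fintype.card ι with hN
  have hball := pow_mul_card_hammingBall_le f d (by norm_num : (0 : ℝ) ≤ 1 / 2) (by norm_num)
  rw [hα, ← hN] at hball
  have hrate : (2 : ℝ) ^ d * (3 / 4) ^ N ≤ Real.exp (-(N / 100)) := by
    refine le_of_pow_le_pow_left₀ (n := 5) (by norm_num) (by positivity) ?_
    calc ((2 : ℝ) ^ d * (3 / 4) ^ N) ^ 5 = 2 ^ (5 * d) * ((3 / 4) ^ 5) ^ N := by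
          rw [mul_pow, ← pow_mul, ← pow_mul, ← pow_mul, mul_comm d, mul_comm N]
      _ ≤ 2 ^ (2 * N) * ((3 / 4) ^ 5) ^ N := by gcongr; norm_num
      _ = (2 ^ 2 * (3 / 4) ^ 5) ^ N := by rw [pow_mul, mul_pow]
      _ ≤ Real.exp (-(1 / 20)) ^ N := by
          gcongr
          linarith [Real.add_one_le_exp (-(1 / 20) : ℝ)]
      _ = Real.exp (-(N / 100)) ^ 5 := by
          rw [← Real.exp_nat_mul, ← Real.exp_nat_mul]
          ring_nf
  calc (#{g | hammingDist g f ≤ d} : ℝ)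
      = 2 ^ d * ((1 / 2) ^ d * #{g | hammingDist g f ≤ d}) := by
        rw [← mul_assoc, ← mul_pow]
        norm_num
    _ ≤ 2 ^ d * (1 + ((2 : ℕ) - 1) * (1 / 2)) ^ N := by gcongr
    _ = 2 ^ d * (3 / 4) ^ N * 2 ^ N := by
        rw [mul_assoc, ← mul_pow]
        norm_num
    _ ≤ Real.exp (-(N / 100)) * Fintype.card (ι → α) := by
        rw [Fintype.card_fun, hα, Nat.cast_pow, Nat.cast_ofNat]
        gcongr

theorem sum_sum_sym2_add_sum_diag {α M : Type*} [Fintype α] [AddCommMonoid M] (φ : Sym2 α → M) :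
    ∑ i, ∑ j, φ s(i, j) + ∑ i, φ s(i, i) = 2 • ∑ z, φ z := by
  classical
  have hfiber (z : Sym2 α) :
      ∑ p : α × α with s(p.1, p.2) = z, φ s(p.1, p.2) + ∑ i with s(i, i) = z, φ s(i, i) =
        2 • φ z := by
    induction z using Sym2.ind with | _ a b => ?_
    obtain rfl | hab := eq_or_ne a b
    · have h₁ : ({p | s(p.1, p.2) = s(a, a)} : Finset (α × α)) = {(a, a)} := by
        ext; simp [Prod.ext_iff]
      have h₂ : ({i | s(i, i) = s(a, a)} : Finset α) = {a} := by ext; simp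
      rw [h₁, h₂, sum_singleton, sum_singleton, two_nsmul]
    · have h₁ : ({p | s(p.1, p.2) = s(a, b)} : Finset (α × α)) = {(a, b), (b, a)} := by
        ext; simp [Prod.ext_iff]
      have h₂ : ({i | s(i, i) = s(a, b)} : Finset α) = ∅ := by
        ext; grind
      rw [h₁, h₂, sum_pair (by simp [hab]), sum_empty, add_zero, Sym2.eq_swap (a := b), two_nsmul]
  rw [← Fintype.sum_prod_type', ← sum_fiberwise univ fun p : α × α => s(p.1, p.2),
    ← sum_fiberwise univ fun i : α => s(i, i), ← sum_add_distrib, sum_congr rfl fun z _ => hfiber z,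
    sum_nsmul]

theorem sq_sum_sum_le_of_card_le {H Ω : Type*} [Fintype H] [Fintype Ω] [DecidableEq Ω]
    (W : H → Ω → ℝ) (A : H → Finset Ω) {L k : ℝ} (hW : ∀ h, ∑ ω, W h ω ^ 2 ≤ L)
    (hA : ∀ ω, (#{h | ω ∈ A h} : ℝ) ≤ k) :
    (∑ h, ∑ ω ∈ A h, W h ω) ^ 2 ≤ (Fintype.card Ω * k) * (Fintype.card H * L) := by
  have hcard : (#(univ.sigma A) : ℝ) ≤ Fintype.card Ω * k := by
    have hcomm := sum_card_bipartiteAbove_eq_sum_card_bipartiteBelow (s := univ) (t := univ)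
      fun h ω => ω ∈ A h
    simp only [bipartiteAbove, bipartiteBelow, filter_univ_mem] at hcomm
    rw [card_sigma, hcomm, Nat.cast_sum]
    simpa using sum_le_sum fun ω (_ : ω ∈ univ) => hA ω
  have hsq : ∑ q ∈ univ.sigma A, W q.1 q.2 ^ 2 ≤ Fintype.card H * L := by
    rw [sum_sigma]
    refine (sum_le_sum fun h _ => ?_).trans_eq (by simp : ∑ _h : H, L = _)
    exact (sum_le_univ_sum_of_nonneg fun ω => sq_nonneg _).trans (hW h)
  calc (∑ h, ∑ ω ∈ A h, W h ω) ^ 2 = (∑ q ∈ univ.sigma A, W q.1 q.2) ^ 2 := by rw [sum_sigma]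
    _ ≤ #(univ.sigma A) * ∑ q ∈ univ.sigma A, W q.1 q.2 ^ 2 := sq_sum_le_card_mul_sum_sq
    _ ≤ (Fintype.card Ω * k) * (Fintype.card H * L) := by
        gcongr
        exact (Nat.cast_nonneg _).trans hcard

theorem sum_sq_prod_le {ι κ : Type*} [Fintype ι] [DecidableEq ι] [Fintype κ] {w : ι → κ → ℝ} {L : ℝ}
    (hw : ∀ i, ∑ y, w i y ^ 2 ≤ L) :
    ∑ ω : ι → κ, (∏ i, w i (ω i)) ^ 2 ≤ L ^ Fintype.card ι := by
  calc ∑ ω : ι → κ, (∏ i, w i (ω i)) ^ 2 = ∏ i, ∑ y, w i y ^ 2 := by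
        simp_rw [← prod_pow, Fintype.prod_sum]
    _ ≤ ∏ _i : ι, L := prod_le_prod (fun i _ => sum_nonneg fun y _ => sq_nonneg _) fun i _ => hw i
    _ = L ^ Fintype.card ι := by rw [prod_const, card_univ]

end Counting

section PACEstimator

open Finset

variable {n m : ℕ}

theorem sampleLaw_real_singleton {P : Matrix (Fin n) (Fin m) ℝ} (hP : ∀ x y, 0 ≤ P x y)
    (Z : Fin n → ℕ) (ω : TransitionSample m Z) :
    (sampleLaw P Z).real {ω} = ∏ s, P s.1 (ω s) := by
  have hfin (x : Fin n) : MeasureTheory.IsFiniteMeasure (rowMeasure P x) :=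
    ⟨by simp [rowMeasure, MeasureTheory.Measure.finsetSum_apply]⟩
  have hrow (x : Fin n) (y : Fin m) : rowMeasure P x {y} = ENNReal.ofReal (P x y) := by
    simp [rowMeasure, MeasureTheory.Measure.finsetSum_apply, Set.indicator_apply, eq_comm]
  rw [MeasureTheory.measureReal_def, sampleLaw, MeasureTheory.Measure.pi_singleton,
    ENNReal.toReal_prod]
  exact prod_congr rfl fun s _ => by rw [hrow, ENNReal.toReal_ofReal (hP _ _)]

theorem isProbabilityMeasure_sampleLaw {P : Matrix (Fin n) (Fin m) ℝ}
    (hP : ∀ x, P x ∈ stdSimplex ℝ (Fin m)) (Z : Fin n → ℕ) :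
    MeasureTheory.IsProbabilityMeasure (sampleLaw P Z) := by
  have hrow (x : Fin n) : MeasureTheory.IsProbabilityMeasure (rowMeasure P x) := by
    refine ⟨?_⟩
    simp only [rowMeasure, MeasureTheory.Measure.finsetSum_apply, MeasureTheory.Measure.smul_apply,
      smul_eq_mul, MeasureTheory.measure_univ, mul_one]
    rw [← ENNReal.ofReal_sum_of_nonneg fun y _ => (hP x).1 y, (hP x).2, ENNReal.ofReal_one]
  exact MeasureTheory.Measure.pi.instIsProbabilityMeasure _

variable {E : Type*} [Sub E] {Pc : Set (Matrix (Fin n) (Fin m) ℝ)}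
  {f : Matrix (Fin n) (Fin m) ℝ → E} {N : E → ℝ} {Z : Fin n → ℕ} {ε δ : ℝ}
  {est : TransitionSample m Z → E}

theorem IsPACEstimator.one_sub_le_sum (hest : IsPACEstimator Pc f N Z ε δ est) (hδ : 0 ≤ δ)
    {P : Matrix (Fin n) (Fin m) ℝ} (hPc : P ∈ Pc) (hP : ∀ x, P x ∈ stdSimplex ℝ (Fin m)) :
    1 - δ ≤ ∑ ω with N (est ω - f P) ≤ ε, ∏ s, P s.1 (ω s) := by
  have := isProbabilityMeasure_sampleLaw hP Z
  have hcompl : {ω | ε < N (est ω - f P)}ᶜ =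
      (({ω | N (est ω - f P) ≤ ε} : Finset (TransitionSample m Z)) : Set _) := by
    ext ω
    simp
  calc 1 - δ ≤ 1 - (sampleLaw P Z).real {ω | ε < N (est ω - f P)} :=
        sub_le_sub_left (ENNReal.toReal_le_of_le_ofReal hδ (hest P hPc)) 1
    _ = (sampleLaw P Z).real ({ω | N (est ω - f P) ≤ ε} : Finset (TransitionSample m Z)) := by
        rw [← hcompl, MeasureTheory.probReal_compl_eq_one_sub (Set.toFinite _).measurableSet]
    _ = _ := by
        rw [← MeasureTheory.sum_measureReal_singleton]
        exact sum_congr rfl fun ω _ => sampleLaw_real_singleton (fun x => (hP x).1) Z ω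

/-- The bound `hc` says that the `χ²` divergence of `P h x` from the uniform law is at most
`Real.exp c - 1`, so that `c` measures the information carried by one transition. -/
theorem IsPACEstimator.sq_one_sub_le {H : Type*} [Fintype H] [Nonempty H]
    (hest : IsPACEstimator Pc f N Z ε δ est) (hδ₀ : 0 ≤ δ) (hδ₁ : δ ≤ 1)
    {P : H → Matrix (Fin n) (Fin m) ℝ} (hPc : ∀ h, P h ∈ Pc)
    (hP : ∀ h x, P h x ∈ stdSimplex ℝ (Fin m)) {c p : ℝ}
    (hc : ∀ h x, ∑ y, P h x y ^ 2 ≤ Real.exp c / m)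
    (hp : ∀ v, (#{h | N (v - f (P h)) ≤ ε} : ℝ) ≤ p * Fintype.card H) :
    (1 - δ) ^ 2 ≤ Real.exp (c * ∑ x, (Z x : ℝ)) * p := by
  classical
  have hcard : (Fintype.card (Σ x : Fin n, Fin (Z x)) : ℝ) = ∑ x, (Z x : ℝ) := by simp
  have hH : (0 : ℝ) < Fintype.card H := by exact_mod_cast Fintype.card_pos
  have hp₀ : 0 ≤ p := nonneg_of_mul_nonneg_left
    ((Nat.cast_nonneg _).trans (hp (f (P (Classical.arbitrary H))))) hH
  have hfano := sq_sum_sum_le_of_card_le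
    (fun h (ω : TransitionSample m Z) => ∏ s, P h s.1 (ω s))
    (fun h => ({ω | N (est ω - f (P h)) ≤ ε} : Finset (TransitionSample m Z)))
    (fun h => sum_sq_prod_le fun s : Σ x : Fin n, Fin (Z x) => hc h s.1)
    (k := p * Fintype.card H) fun ω => by simpa using hp (est ω)
  have hinfo : (Fintype.card (TransitionSample m Z) : ℝ) *
      (Real.exp c / m) ^ Fintype.card (Σ x : Fin n, Fin (Z x)) ≤
        Real.exp (c * ∑ x, (Z x : ℝ)) := by
    rw [Fintype.card_fun, Fintype.card_fin, Nat.cast_pow, ← mul_pow, mul_comm c, ← hcard,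
      Real.exp_nat_mul]
    gcongr
    rcases eq_or_ne (m : ℝ) 0 with hm | hm
    · simp [hm, Real.exp_nonneg]
    · rw [mul_div_cancel₀ _ hm]
  refine le_of_mul_le_mul_right ?_ (pow_pos hH 2)
  calc (1 - δ) ^ 2 * Fintype.card H ^ 2 = (∑ _h : H, (1 - δ)) ^ 2 := by
        rw [sum_const, card_univ, nsmul_eq_mul, mul_pow, mul_comm]
    _ ≤ (∑ h, ∑ ω with N (est ω - f (P h)) ≤ ε, ∏ s, P h s.1 (ω s)) ^ 2 := by
        have := sub_nonneg.2 hδ₁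
        gcongr with h
        exact hest.one_sub_le_sum hδ₀ (hPc h) (hP h)
    _ ≤ _ := hfano
    _ = (Fintype.card (TransitionSample m Z) *
          (Real.exp c / m) ^ Fintype.card (Σ x : Fin n, Fin (Z x))) * p * Fintype.card H ^ 2 := by
        ring
    _ ≤ _ := by gcongr

theorem sum_abs_le_inftyInftyNorm (A : Matrix (Fin n) (Fin m) ℝ) (x : Fin n) :
    ∑ y, |A x y| ≤ inftyInftyNorm A := by
  let _ := Matrix.linftyOpNormedAddCommGroup (m := Fin n) (n := Fin m) (α := ℝ)
  rw [inftyInftyNorm, ← Matrix.linfty_opNorm_eq_opNorm, Matrix.linfty_opNorm_def]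
  have hx := Finset.le_sup (f := fun x => ∑ y, ‖A x y‖₊) (mem_univ x)
  simpa using NNReal.coe_le_coe.2 hx

theorem inftyInftyNorm_sub_le (A B : Matrix (Fin n) (Fin m) ℝ) :
    inftyInftyNorm (A - B) ≤ inftyInftyNorm A + inftyInftyNorm B := by
  let _ := Matrix.linftyOpNormedAddCommGroup (m := Fin n) (n := Fin m) (α := ℝ)
  simp only [inftyInftyNorm, ← Matrix.linfty_opNorm_eq_opNorm]
  exact norm_sub_le A B

end PACEstimator

section UniformPerturbation

open Finset

theorem uniformWeight_pos {n : ℕ} (x : Fin n) : 0 < uniformWeight n x :=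
  one_div_pos.2 (Nat.cast_pos.2 x.pos)

/-- The admissible directions of perturbation: kernels with entries in `[-1, 1]` and vanishing row
sums, so that `1 + t * B x y` is for `0 ≤ t ≤ 1` a density of a transition kernel with respect to
the uniform law. -/
structure IsBalancedKernel {ι : Type*} [Fintype ι] (B : Matrix ι ι ℝ) : Prop where
  abs_le_one : ∀ x y, |B x y| ≤ 1
  sum_eq_zero : ∀ x, ∑ y, B x y = 0

/-- The perturbation of size `t`, in the direction `B`, of the chain on `Fin n` that jumps to a
uniform state at each step. -/
noncomputable def uniformPerturbation {n : ℕ} (t : ℝ) (B : Matrix (Fin n) (Fin n) ℝ) :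
    Matrix (Fin n) (Fin n) ℝ :=
  Matrix.of fun x y => (1 + t * B x y) / n

theorem IsBalancedKernel.submatrix {ι κ : Type*} [Fintype ι] [Fintype κ] {B : Matrix ι ι ℝ}
    (hB : IsBalancedKernel B) (e : κ ≃ ι) : IsBalancedKernel (B.submatrix e e) where
  abs_le_one x y := hB.abs_le_one (e x) (e y)
  sum_eq_zero x := (e.sum_comp (B (e x))).trans (hB.sum_eq_zero (e x))

variable {n : ℕ} {t : ℝ} {B : Matrix (Fin n) (Fin n) ℝ}

namespace IsBalancedKernel

theorem uniformPerturbation_mem_stdSimplex (hB : IsBalancedKernel B) (ht₀ : 0 ≤ t) (ht₁ : t ≤ 1)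
    (x : Fin n) : uniformPerturbation t B x ∈ stdSimplex ℝ (Fin n) := by
  refine ⟨fun y => div_nonneg ?_ n.cast_nonneg, ?_⟩
  · have hneg : -(t * B x y) ≤ t * |B x y| := by
      rw [← mul_neg]
      exact mul_le_mul_of_nonneg_left (neg_le_abs _) ht₀
    linarith [mul_le_one₀ ht₁ (abs_nonneg (B x y)) (hB.abs_le_one x y)]
  · have hn : (n : ℝ) ≠ 0 := Nat.cast_ne_zero.2 x.pos.ne'
    simp only [uniformPerturbation, Matrix.of_apply]
    rw [← sum_div, sum_add_distrib, ← mul_sum, hB.sum_eq_zero]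
    simp [hn]

theorem uniformPerturbation_mem_rowStochastic (hB : IsBalancedKernel B) (ht₀ : 0 ≤ t)
    (ht₁ : t ≤ 1) : uniformPerturbation t B ∈ Matrix.rowStochastic ℝ (Fin n) :=
  Matrix.mem_rowStochastic_iff_sum.2
    ⟨fun x => (hB.uniformPerturbation_mem_stdSimplex ht₀ ht₁ x).1,
      fun x => (hB.uniformPerturbation_mem_stdSimplex ht₀ ht₁ x).2⟩

theorem sum_sq_uniformPerturbation_le (hB : IsBalancedKernel B) (t : ℝ) (x : Fin n) :
    ∑ y, uniformPerturbation t B x y ^ 2 ≤ (1 + t ^ 2) / n := by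
  have hn : (n : ℝ) ≠ 0 := Nat.cast_ne_zero.2 x.pos.ne'
  have hBsq : ∑ y, B x y ^ 2 ≤ n := by
    calc ∑ y, B x y ^ 2 ≤ ∑ _y : Fin n, 1 :=
          sum_le_sum fun y _ => (sq_le_one_iff_abs_le_one _).2 (hB.abs_le_one x y)
      _ = n := by simp
  calc ∑ y, uniformPerturbation t B x y ^ 2
      = (∑ y, (1 + 2 * t * B x y + t ^ 2 * B x y ^ 2)) / n ^ 2 := by
        rw [sum_div]
        refine sum_congr rfl fun y _ => ?_
        rw [uniformPerturbation, Matrix.of_apply, div_pow]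
        ring
    _ = (n + t ^ 2 * ∑ y, B x y ^ 2) / n ^ 2 := by
        rw [sum_add_distrib, sum_add_distrib, ← mul_sum, ← mul_sum, hB.sum_eq_zero]
        simp
    _ ≤ (n + t ^ 2 * n) / n ^ 2 := by gcongr
    _ = (1 + t ^ 2) / n := by field_simp

theorem spectralRecoverability_uniformPerturbation_le_of_sq (hB : IsBalancedKernel B) {κ : ℝ}
    (hκ : 0 ≤ κ) (htκ : (1 + t ^ 2) * n ≤ κ ^ 2) :
    spectralRecoverability (uniformWeight n) (uniformPerturbation t B) ≤ κ := by
  refine spectralRecoverability_le_of_sum_sq_le uniformWeight_pos hκ fun x => ?_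
  have hn : (n : ℝ) ≠ 0 := Nat.cast_ne_zero.2 x.pos.ne'
  calc (∑ y, uniformPerturbation t B x y ^ 2 / uniformWeight n y) / uniformWeight n x
      = (∑ y, uniformPerturbation t B x y ^ 2) * n ^ 2 := by
        simp only [uniformWeight]
        rw [← sum_div]
        field_simp
    _ ≤ (1 + t ^ 2) / n * n ^ 2 := by gcongr; exact hB.sum_sq_uniformPerturbation_le t x
    _ = (1 + t ^ 2) * n := by field_simp
    _ ≤ κ ^ 2 := htκ

theorem spectralRecoverability_uniformPerturbation_le_of_posSemidef (hB : IsBalancedKernel B)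
    (hpos : B.PosSemidef) (ht : 0 ≤ t) :
    spectralRecoverability (uniformWeight n) (uniformPerturbation t B) ≤ 1 + t := by
  have hpsd : (Matrix.diagonal (uniformWeight n) * uniformPerturbation t B).PosSemidef := by
    have heq : Matrix.diagonal (uniformWeight n) * uniformPerturbation t B =
        (1 / (n : ℝ) ^ 2) • (Matrix.vecMulVec 1 (star 1) + t • B) := by
      ext x y
      simp only [uniformPerturbation, uniformWeight, Matrix.diagonal_mul, Matrix.of_apply,
        Matrix.smul_apply, Matrix.add_apply, Matrix.vecMulVec_apply, Pi.one_apply, star_one,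
        smul_eq_mul]
      ring
    rw [heq]
    exact ((Matrix.posSemidef_vecMulVec_self_star 1).add (hpos.smul ht)).smul (by positivity)
  rw [spectralRecoverability_eq_iSup_diag uniformWeight_pos hpsd]
  refine Real.iSup_le (fun x => ?_) (by positivity)
  have hn : (n : ℝ) ≠ 0 := Nat.cast_ne_zero.2 x.pos.ne'
  calc uniformPerturbation t B x x / uniformWeight n x = 1 + t * B x x := by
        simp only [uniformPerturbation, uniformWeight, Matrix.of_apply]
        field_simp
    _ ≤ 1 + t := by
        have := mul_le_mul_of_nonneg_left (le_of_abs_le (hB.abs_le_one x x)) ht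
        linarith

end IsBalancedKernel

theorem isReversibleWeight_uniformPerturbation (hB : B.IsSymm) (t : ℝ) :
    IsReversibleWeight (uniformWeight n) (uniformPerturbation t B) := fun x y => by
  simp only [uniformPerturbation, uniformWeight, Matrix.of_apply, hB.apply x y]

theorem IsReversibleWeight.isInvariantWeight {ν : Fin n → ℝ} {P : Matrix (Fin n) (Fin n) ℝ}
    (hrev : IsReversibleWeight ν P) (hP : P ∈ Matrix.rowStochastic ℝ (Fin n)) :
    IsInvariantWeight ν P := by
  ext y
  calc Matrix.vecMul ν P y = ∑ x, ν x * P x y := rfl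
    _ = ∑ x, ν y * P y x := sum_congr rfl fun x _ => hrev x y
    _ = ν y := by rw [← mul_sum, Matrix.sum_row_of_mem_rowStochastic hP, mul_one]

theorem mul_sum_abs_sub_le_of_inftyInftyNorm_le {B' Q : Matrix (Fin n) (Fin n) ℝ} {ε : ℝ}
    (h : inftyInftyNorm (Q - uniformPerturbation t B) ≤ ε)
    (h' : inftyInftyNorm (Q - uniformPerturbation t B') ≤ ε) (x : Fin n) :
    |t| * ∑ y, |B x y - B' x y| ≤ 2 * ε * n := by
  have hn : (0 : ℝ) < n := Nat.cast_pos.2 x.pos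
  rw [← div_le_iff₀ hn]
  calc |t| * (∑ y, |B x y - B' x y|) / n
      = ∑ y, |((Q - uniformPerturbation t B') - (Q - uniformPerturbation t B)) x y| := by
        rw [mul_sum, sum_div]
        refine sum_congr rfl fun y _ => ?_
        rw [← abs_mul, ← abs_of_pos hn, ← abs_div]
        simp only [uniformPerturbation, Matrix.sub_apply, Matrix.of_apply]
        ring_nf
    _ ≤ inftyInftyNorm ((Q - uniformPerturbation t B') - (Q - uniformPerturbation t B)) :=
        sum_abs_le_inftyInftyNorm _ x
    _ ≤ ε + ε := (inftyInftyNorm_sub_le _ _).trans (add_le_add h' h)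
    _ = 2 * ε := (two_mul ε).symm

end UniformPerturbation

section PairedKernel

open Finset

/-- Doubling each index `i` into a pair `(i, 1)`, `(i, -1)` turns an arbitrary matrix of signs into
a kernel whose row sums vanish. The kernel is extended by zero to `ρ`, which serves to reach index
sets of odd size. -/
def pairedKernel {ι : Type*} (ρ : Type*) (a : Matrix ι ι ℤˣ) :
    Matrix ((ι × ℤˣ) ⊕ ρ) ((ι × ℤˣ) ⊕ ρ) ℝ :=
  Matrix.fromBlocks (Matrix.of fun x y => ((x.2 * y.2 * a x.1 y.1 : ℤˣ) : ℤ)) 0 0 0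

variable {ι ρ : Type*}

theorem isSymm_pairedKernel {a : Matrix ι ι ℤˣ} (ha : a.IsSymm) : (pairedKernel ρ a).IsSymm := by
  refine Matrix.IsSymm.fromBlocks (Matrix.IsSymm.ext fun x y => ?_) (by simp) (by simp)
  rw [Matrix.of_apply, Matrix.of_apply, ha.apply, mul_comm x.2]

theorem posSemidef_pairedKernel_vecMulVec [Finite ι] [Finite ρ] (u : ι → ℤˣ) :
    (pairedKernel ρ (Matrix.vecMulVec u u)).PosSemidef := by
  let w : (ι × ℤˣ) ⊕ ρ → ℝ := Sum.elim (fun x => ((x.2 * u x.1 : ℤˣ) : ℤ)) 0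
  have heq : pairedKernel ρ (Matrix.vecMulVec u u) = Matrix.vecMulVec w (star w) := by
    ext (x | x) (y | y)
    · simp only [pairedKernel, Matrix.vecMulVec_apply, w, Matrix.fromBlocks_apply₁₁,
        Matrix.of_apply, Sum.elim_inl, star_trivial, Units.val_mul, Int.cast_mul]
      ring
    all_goals simp [pairedKernel, Matrix.vecMulVec_apply, w]
  rw [heq]
  exact Matrix.posSemidef_vecMulVec_self_star w

variable [Fintype ι] [Fintype ρ] {n : ℕ}

theorem isBalancedKernel_pairedKernel (a : Matrix ι ι ℤˣ) :
    IsBalancedKernel (pairedKernel ρ a) where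
  abs_le_one := by
    rintro (x | x) (y | y)
    · rw [pairedKernel, Matrix.fromBlocks_apply₁₁, Matrix.of_apply, abs_unit_intCast]
    all_goals simp [pairedKernel]
  sum_eq_zero := by
    rintro (x | x) <;>
      simp [pairedKernel, Fintype.sum_sum_type, Fintype.sum_prod_type, UnitsInt.univ]

theorem sum_abs_pairedKernel_sub (a b : Matrix ι ι ℤˣ) (x : ι × ℤˣ) :
    ∑ y, |pairedKernel ρ a (Sum.inl x) y - pairedKernel ρ b (Sum.inl x) y| =
      4 * hammingDist (a x.1) (b x.1) := by
  have hunits (u v : ℤˣ) : |((u : ℤ) : ℝ) - (v : ℤ)| = 2 * if u ≠ v then 1 else 0 := by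
    rcases Int.units_eq_one_or u with rfl | rfl <;>
      rcases Int.units_eq_one_or v with rfl | rfl <;> norm_num
  calc ∑ y, |pairedKernel ρ a (Sum.inl x) y - pairedKernel ρ b (Sum.inl x) y|
      = ∑ j, ∑ s : ℤˣ, |((x.2 * s * a x.1 j : ℤˣ) : ℝ) - ((x.2 * s * b x.1 j : ℤˣ) : ℝ)| := by
        simp [pairedKernel, Fintype.sum_sum_type, Fintype.sum_prod_type]
    _ = ∑ j, ∑ _s : ℤˣ, 2 * if a x.1 j ≠ b x.1 j then 1 else 0 := by
        simp only [hunits, ne_eq, mul_right_inj]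
    _ = 4 * hammingDist (a x.1) (b x.1) := by
        simp only [sum_const, card_univ, Fintype.card_units_int, ← smul_sum, ← mul_sum, sum_boole]
        rw [hammingDist, nsmul_eq_mul, ← mul_assoc]
        norm_num

theorem three_mul_hammingDist_le_of_inftyInftyNorm_le (hρ : Fintype.card ρ ≤ 1)
    (e : Fin n ≃ (ι × ℤˣ) ⊕ ρ) {a b : Matrix ι ι ℤˣ} {Q : Matrix (Fin n) (Fin n) ℝ} {ε : ℝ}
    (hε : 0 < ε)
    (ha : inftyInftyNorm (Q - uniformPerturbation (3 * ε) ((pairedKernel ρ a).submatrix e e)) ≤ ε)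
    (hb : inftyInftyNorm (Q - uniformPerturbation (3 * ε) ((pairedKernel ρ b).submatrix e e)) ≤ ε)
    (i : ι) : 3 * hammingDist (a i) (b i) ≤ Fintype.card ι := by
  have hn : n = 2 * Fintype.card ι + Fintype.card ρ := by
    simpa [mul_comm] using Fintype.card_congr e
  have hclose := mul_sum_abs_sub_le_of_inftyInftyNorm_le ha hb (e.symm (Sum.inl (i, 1)))
  simp only [Matrix.submatrix_apply, e.apply_symm_apply] at hclose
  rw [e.sum_comp fun y => |pairedKernel ρ a (Sum.inl (i, 1)) y - pairedKernel ρ b _ y|,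
    sum_abs_pairedKernel_sub, abs_of_pos (by positivity)] at hclose
  have hdist : (6 * hammingDist (a i) (b i) : ℝ) ≤ n :=
    le_of_mul_le_mul_left (by linarith) (by positivity : 0 < 2 * ε)
  have hdist' : 6 * hammingDist (a i) (b i) ≤ n := by exact_mod_cast hdist
  omega

theorem IsPACEstimator.sq_one_sub_le_of_signs (hρ : Fintype.card ρ ≤ 1)
    (e : Fin n ≃ (ι × ℤˣ) ⊕ ρ) {H : Type*} [Fintype H] [Nonempty H] {a : H → Matrix ι ι ℤˣ}
    {ε δ p : ℝ} {Z : Fin n → ℕ} {est : TransitionSample n Z → Matrix (Fin n) (Fin n) ℝ}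
    {Pc : Set (Matrix (Fin n) (Fin n) ℝ)} (hest : IsPACEstimator Pc id inftyInftyNorm Z ε δ est)
    (hδ₀ : 0 ≤ δ) (hδ₁ : δ ≤ 1) (hε₀ : 0 < ε) (hε₁ : 3 * ε ≤ 1)
    (hPc : ∀ h, uniformPerturbation (3 * ε) ((pairedKernel ρ (a h)).submatrix e e) ∈ Pc)
    (hp : ∀ h₀, (#{h | ∀ i, 3 * hammingDist (a h i) (a h₀ i) ≤ Fintype.card ι} : ℝ) ≤
      p * Fintype.card H) :
    (1 - δ) ^ 2 ≤ Real.exp ((3 * ε) ^ 2 * ∑ x, (Z x : ℝ)) * p := by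
  have hB (h : H) : IsBalancedKernel ((pairedKernel ρ (a h)).submatrix e e) :=
    (isBalancedKernel_pairedKernel (a h)).submatrix e
  refine hest.sq_one_sub_le hδ₀ hδ₁ hPc
    (fun h => (hB h).uniformPerturbation_mem_stdSimplex (by positivity) hε₁)
    (fun h x => ((hB h).sum_sq_uniformPerturbation_le _ x).trans ?_) fun Q => ?_
  · gcongr
    linarith [Real.add_one_le_exp ((3 * ε) ^ 2)]
  simp only [id_eq]
  by_cases hQ : ∃ h₀, inftyInftyNorm (Q - uniformPerturbation (3 * ε)
      ((pairedKernel ρ (a h₀)).submatrix e e)) ≤ ε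
  · obtain ⟨h₀, hh₀⟩ := hQ
    refine le_trans (Nat.cast_le.2 (card_le_card (monotone_filter_right _ fun h _ hh => ?_)))
      (hp h₀)
    exact three_mul_hammingDist_le_of_inftyInftyNorm_le hρ e hε₀ hh hh₀
  · rw [filter_false_of_mem fun h _ hh => hQ ⟨h, hh⟩, card_empty, Nat.cast_zero]
    exact (Nat.cast_nonneg _).trans (hp (Classical.arbitrary H))

end PairedKernel

section SignFamilies

open Finset

variable {ι : Type*} [Fintype ι]

theorem hammingDist_vecMulVec_self (u v : ι → ℤˣ) (i : ι) :
    hammingDist (Matrix.vecMulVec u u i) (Matrix.vecMulVec v v i) = hammingDist u v ∨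
    hammingDist (Matrix.vecMulVec u u i) (Matrix.vecMulVec v v i) = hammingDist u (-v) := by
  have hrow (w : ι → ℤˣ) : Matrix.vecMulVec w w i = w i • w := rfl
  have hsmul (w : ι → ℤˣ) : hammingDist (u i • u) (u i • w) = hammingDist u w :=
    hammingDist_smul fun _ => isSMulRegular_of_group (u i)
  rw [hrow, hrow]
  obtain h | h := eq_or_ne (v i) (u i)
  · left
    rw [h, hsmul]
  · right
    have hneg : -u i • v = u i • -v := funext fun j => neg_mul_comm (u i) (v j)
    rw [Int.units_ne_iff_eq_neg.1 h, hneg, hsmul]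

theorem card_vecMulVec_self_near_le [DecidableEq ι] [Nonempty ι] (v : ι → ℤˣ) :
    (#{u : ι → ℤˣ | ∀ i, 3 * hammingDist (Matrix.vecMulVec u u i) (Matrix.vecMulVec v v i) ≤
      Fintype.card ι} : ℝ) ≤
      2 * Real.exp (-(Fintype.card ι / 100)) * Fintype.card (ι → ℤˣ) := by
  set d := Fintype.card ι / 3
  have hball (w : ι → ℤˣ) := card_hammingBall_le_exp Fintype.card_units_int w
    (d := d) (by omega)
  have hsub : ({u : ι → ℤˣ | ∀ i, 3 * hammingDist (Matrix.vecMulVec u u i)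
      (Matrix.vecMulVec v v i) ≤ Fintype.card ι} : Finset (ι → ℤˣ)) ⊆
      ({u | hammingDist u v ≤ d} : Finset _) ∪ ({u | hammingDist u (-v) ≤ d} : Finset _) := by
    intro u hu
    have hi := (mem_filter_univ u).1 hu (Classical.arbitrary ι)
    rw [mem_union, mem_filter_univ, mem_filter_univ, Nat.le_div_iff_mul_le three_pos,
      Nat.le_div_iff_mul_le three_pos]
    have := hammingDist_vecMulVec_self u v (Classical.arbitrary ι)
    omega
  calc _ ≤ ((#{u | hammingDist u v ≤ d} + #{u | hammingDist u (-v) ≤ d} : ℕ) : ℝ) :=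
        Nat.cast_le.2 ((card_le_card hsub).trans (card_union_le _ _))
    _ ≤ _ := by
        push_cast
        linarith [hball v, hball (-v)]

/-- The symmetric matrix with prescribed entries at the unordered pairs of indices. Symmetric sign
matrices are thereby indexed by the functions `Sym2 ι → ℤˣ`, which carry a Hamming distance. -/
def symmetricMatrix {ι α : Type*} (h : Sym2 ι → α) : Matrix ι ι α :=
  Matrix.of fun i j => h s(i, j)

theorem isSymm_symmetricMatrix {ι α : Type*} (h : Sym2 ι → α) : (symmetricMatrix h).IsSymm :=
  Matrix.IsSymm.ext fun _ _ => congrArg h Sym2.eq_swap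

theorem two_mul_hammingDist_le_sum_symmetricMatrix {α : Type*} [DecidableEq α] (g h : Sym2 ι → α) :
    2 * hammingDist g h ≤
      ∑ i, hammingDist (symmetricMatrix g i) (symmetricMatrix h i) + Fintype.card ι := by
  have hsum := sum_sum_sym2_add_sum_diag fun z => if g z ≠ h z then 1 else 0
  rw [← card_filter] at hsum
  simp only [smul_eq_mul, ← card_filter] at hsum
  calc 2 * hammingDist g h = _ := hsum.symm
    _ ≤ _ := add_le_add le_rfl (card_filter_le ..)

theorem card_symmetricMatrix_near_le [DecidableEq ι] (hι : 9 ≤ Fintype.card ι) (h₀ : Sym2 ι → ℤˣ) :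
    (#{h : Sym2 ι → ℤˣ | ∀ i, 3 * hammingDist (symmetricMatrix h i) (symmetricMatrix h₀ i) ≤
      Fintype.card ι} : ℝ) ≤
      Real.exp (-(Fintype.card (Sym2 ι) / 100)) * Fintype.card (Sym2 ι → ℤˣ) := by
  refine le_trans (Nat.cast_le.2 (card_le_card fun h hh => ?_))
    (card_hammingBall_le_exp Fintype.card_units_int h₀ (d := 2 * Fintype.card (Sym2 ι) / 5)
      (by omega))
  have hrow := (mem_filter.1 hh).2
  have hcard : 2 * Fintype.card (Sym2 ι) = (Fintype.card ι + 1) * Fintype.card ι := by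
    rw [Sym2.card, Nat.choose_two_right, Nat.add_sub_cancel, Nat.mul_div_cancel']
    exact mul_comm (Fintype.card ι) _ ▸ (Nat.even_mul_succ_self _).two_dvd
  have hrows : 3 * ∑ i, hammingDist (symmetricMatrix h i) (symmetricMatrix h₀ i) ≤
      Fintype.card ι * Fintype.card ι := by
    rw [mul_sum]
    simpa using sum_le_sum fun i (_ : i ∈ univ) => hrow i
  have hdist := two_mul_hammingDist_le_sum_symmetricMatrix h h₀
  rw [mem_filter, Nat.le_div_iff_mul_le (by norm_num)]
  refine ⟨mem_univ h, ?_⟩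
  nlinarith

end SignFamilies

section LowerBound

variable {n : ℕ} {κ : ℝ}

/-- The class `𝒫_κ` of all chains to be estimated: transition matrices that are reversible with
uniform invariant measure and have spectral recoverability at most `κ`. -/
def recoverableChains (n : ℕ) (κ : ℝ) : Set (Matrix (Fin n) (Fin n) ℝ) :=
  {P | (P ∈ Matrix.rowStochastic ℝ (Fin n) ∧ IsReversibleWeight (uniformWeight n) P ∧
    IsInvariantWeight (uniformWeight n) P) ∧ spectralRecoverability (uniformWeight n) P ≤ κ}

theorem IsBalancedKernel.uniformPerturbation_mem_recoverableChains {t : ℝ}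
    {B : Matrix (Fin n) (Fin n) ℝ} (hB : IsBalancedKernel B) (hsymm : B.IsSymm) (ht₀ : 0 ≤ t)
    (ht₁ : t ≤ 1) (hξ : spectralRecoverability (uniformWeight n) (uniformPerturbation t B) ≤ κ) :
    uniformPerturbation t B ∈ recoverableChains n κ :=
  have hstoch := hB.uniformPerturbation_mem_rowStochastic ht₀ ht₁
  have hrev := isReversibleWeight_uniformPerturbation hsymm t
  ⟨⟨hstoch, hrev, hrev.isInvariantWeight hstoch⟩, hξ⟩

theorem nonempty_equiv_fin_prod_units_sum (n : ℕ) :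
    Nonempty (Fin n ≃ (Fin (n / 2) × ℤˣ) ⊕ Fin (n % 2)) :=
  ⟨Fintype.equivOfCardEq <| by
    rw [Fintype.card_sum, Fintype.card_prod, Fintype.card_fin, Fintype.card_fin, Fintype.card_fin,
      Fintype.card_units_int, Nat.div_add_mod']⟩

theorem le_add_seven_of_sq_one_sub_le {δ s x : ℝ} (hδ : δ ≤ 1 / 2)
    (h : (1 - δ) ^ 2 ≤ Real.exp s * (2 * Real.exp (-x))) : x ≤ s + 7 := by
  have hδ' : 1 / 4 ≤ (1 - δ) ^ 2 := by nlinarith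
  have hexp : Real.exp (x - s) * (Real.exp s * (2 * Real.exp (-x))) = 2 := by
    rw [mul_left_comm (Real.exp s), mul_left_comm, ← Real.exp_add, ← Real.exp_add,
      ← sub_eq_add_neg, sub_add_sub_cancel, sub_self, Real.exp_zero, mul_one]
  have hle : Real.exp (x - s) * (1 / 4) ≤ 2 :=
    (mul_le_mul_of_nonneg_left (hδ'.trans h) (Real.exp_nonneg _)).trans_eq hexp
  linarith [Real.add_one_le_exp (x - s)]

variable {ε δ : ℝ} {Z : Fin n → ℕ} {est : TransitionSample n Z → Matrix (Fin n) (Fin n) ℝ}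

theorem IsPACEstimator.lt_sq_mul_sum_of_one_add_le
    (hest : IsPACEstimator (recoverableChains n κ) id inftyInftyNorm Z ε δ est) (hn : 2000 ≤ n)
    (hδ₀ : 0 ≤ δ) (hδ₁ : δ ≤ 1 / 2) (hε₀ : 0 < ε) (hε₁ : 3 * ε ≤ 1) (hκ : 1 + 3 * ε ≤ κ) :
    (n : ℝ) / 10000 < ε ^ 2 * ∑ x, (Z x : ℝ) := by
  obtain ⟨e⟩ := nonempty_equiv_fin_prod_units_sum n
  have : Nonempty (Fin (n / 2)) := ⟨0, by omega⟩
  have hmem (u : Fin (n / 2) → ℤˣ) : uniformPerturbation (3 * ε)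
      ((pairedKernel (Fin (n % 2)) (Matrix.vecMulVec u u)).submatrix e e) ∈
        recoverableChains n κ := by
    have hB := (isBalancedKernel_pairedKernel (ρ := Fin (n % 2))
      (Matrix.vecMulVec u u)).submatrix e
    have hpos := (posSemidef_pairedKernel_vecMulVec (ρ := Fin (n % 2)) u).submatrix e
    have hsymm : (Matrix.vecMulVec u u).IsSymm := Matrix.transpose_vecMulVec u u
    exact hB.uniformPerturbation_mem_recoverableChains ((isSymm_pairedKernel hsymm).submatrix e)
      (by positivity) hε₁
      ((hB.spectralRecoverability_uniformPerturbation_le_of_posSemidef hpos (by positivity)).trans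
        hκ)
  have hbound := le_add_seven_of_sq_one_sub_le hδ₁ <|
    hest.sq_one_sub_le_of_signs ((Fintype.card_fin _).trans_le (by omega)) e hδ₀
      (by linarith) hε₀ hε₁ hmem card_vecMulVec_self_near_le
  have hm : (n : ℝ) ≤ 2 * (n / 2 : ℕ) + 1 := by exact_mod_cast (by omega : n ≤ 2 * (n / 2) + 1)
  have hn' : (2000 : ℝ) ≤ n := by exact_mod_cast hn
  rw [Fintype.card_fin] at hbound
  linarith

theorem IsPACEstimator.lt_sq_mul_sum_of_two_mul_le
    (hest : IsPACEstimator (recoverableChains n κ) id inftyInftyNorm Z ε δ est) (hn : 2000 ≤ n)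
    (hδ₀ : 0 ≤ δ) (hδ₁ : δ ≤ 1 / 2) (hε₀ : 0 < ε) (hε₁ : 3 * ε ≤ 1) (hκ₀ : 0 ≤ κ)
    (hκ : 2 * n ≤ κ ^ 2) : (n : ℝ) ^ 2 / 10000 < ε ^ 2 * ∑ x, (Z x : ℝ) := by
  obtain ⟨e⟩ := nonempty_equiv_fin_prod_units_sum n
  have hmem (h : Sym2 (Fin (n / 2)) → ℤˣ) : uniformPerturbation (3 * ε)
      ((pairedKernel (Fin (n % 2)) (symmetricMatrix h)).submatrix e e) ∈
        recoverableChains n κ := by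
    have hB := (isBalancedKernel_pairedKernel (ρ := Fin (n % 2)) (symmetricMatrix h)).submatrix e
    have hsymm := (isSymm_pairedKernel (ρ := Fin (n % 2)) (isSymm_symmetricMatrix h)).submatrix e
    refine hB.uniformPerturbation_mem_recoverableChains hsymm (by positivity) hε₁
      (hB.spectralRecoverability_uniformPerturbation_le_of_sq hκ₀ (le_trans ?_ hκ))
    gcongr
    nlinarith
  have hcount (h₀ : Sym2 (Fin (n / 2)) → ℤˣ) :=
    (card_symmetricMatrix_near_le (by rw [Fintype.card_fin]; omega) h₀).trans <|
      mul_le_mul_of_nonneg_right (le_mul_of_one_le_left (Real.exp_nonneg _) one_le_two)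
        (Nat.cast_nonneg _)
  have hbound := le_add_seven_of_sq_one_sub_le hδ₁ <|
    hest.sq_one_sub_le_of_signs ((Fintype.card_fin _).trans_le (by omega)) e hδ₀
      (by linarith) hε₀ hε₁ hmem hcount
  have hm : (n : ℝ) ≤ 2 * (n / 2 : ℕ) + 1 := by exact_mod_cast (by omega : n ≤ 2 * (n / 2) + 1)
  have hn' : (2000 : ℝ) ≤ n := by exact_mod_cast hn
  rw [Sym2.card, Fintype.card_fin, Nat.cast_choose_two] at hbound
  push_cast at hbound
  nlinarith

theorem IsPACEstimator.max_lt_sq_mul_sum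
    (hest : IsPACEstimator (recoverableChains n κ) id inftyInftyNorm Z ε δ est) (hn : 2000 ≤ n)
    (hδ₀ : 0 ≤ δ) (hδ₁ : δ ≤ 1 / 2) (hε₀ : 0 < ε) (hε₁ : 3 * ε ≤ 1) (hκ : 1 + 3 * ε ≤ κ)
    (hκn : κ ≤ n) : max (n : ℝ) (κ ^ 2) / 20000 < ε ^ 2 * ∑ x, (Z x : ℝ) := by
  have hκ₀ : 0 ≤ κ := by linarith
  have hn' : (2000 : ℝ) ≤ n := by exact_mod_cast hn
  obtain hlow | hhigh := lt_or_ge (κ ^ 2) (2 * n)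
  · have hmax : max (n : ℝ) (κ ^ 2) ≤ 2 * n := max_le (by linarith) hlow.le
    linarith [hest.lt_sq_mul_sum_of_one_add_le hn hδ₀ hδ₁ hε₀ hε₁ hκ]
  · have hmax : max (n : ℝ) (κ ^ 2) ≤ n ^ 2 := max_le (by nlinarith) (by gcongr)
    linarith [hest.lt_sq_mul_sum_of_two_mul_le hn hδ₀ hδ₁ hε₀ hε₁ hκ₀ hhigh, sq_nonneg (n : ℝ)]

end LowerBound

theorem mainTheorem8 :
    ∃ C : ℝ, 0 < C ∧ ∃ n₀ : ℕ, ∀ n : ℕ, n₀ ≤ n → ∀ κ : ℝ, 1 ≤ κ → κ ≤ n →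
      ∃ Pc : Set (Matrix (Fin n) (Fin n) ℝ),
        (∀ P ∈ Pc, P ∈ Matrix.rowStochastic ℝ (Fin n) ∧
          IsReversibleWeight (uniformWeight n) P ∧ IsInvariantWeight (uniformWeight n) P) ∧
        (∀ P ∈ Pc, spectralRecoverability (uniformWeight n) P ≤ κ) ∧
        ∀ ε : ℝ, 0 < ε → ε < 1 / 3 → 3 * ε ≤ κ - 1 →
          ∀ δ : ℝ, 0 ≤ δ → δ ≤ 1 / 2 →
            ∀ Z : Fin n → ℕ, (∑ x, (Z x : ℝ)) ≤ C * (ε ^ 2)⁻¹ * max (n : ℝ) (κ ^ 2) →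
              ¬ ∃ est : TransitionSample n Z → Matrix (Fin n) (Fin n) ℝ,
                IsPACEstimator Pc id inftyInftyNorm Z ε δ est := by
  refine ⟨1 / 20000, by norm_num, 2000, fun n hn κ _ hκn => ⟨recoverableChains n κ,
    fun P hP => hP.1, fun P hP => hP.2, ?_⟩⟩
  rintro ε hε₀ hε₁ hκ δ hδ₀ hδ₁ Z hZ ⟨est, hest⟩
  have hlower := hest.max_lt_sq_mul_sum hn hδ₀ hδ₁ hε₀ (by linarith) (by linarith) hκn
  have hupper : ε ^ 2 * ∑ x, (Z x : ℝ) ≤ max (n : ℝ) (κ ^ 2) / 20000 := by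
    calc ε ^ 2 * ∑ x, (Z x : ℝ)
        ≤ ε ^ 2 * (1 / 20000 * (ε ^ 2)⁻¹ * max (n : ℝ) (κ ^ 2)) := by gcongr
      _ = max (n : ℝ) (κ ^ 2) / 20000 := by field_simp
  exact hlower.not_ge hupper
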